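/- Let $r$ be a positive integer and let $n$ be a nonnegative integer. Consider lattice paths in $\mathbb{Z}^2$ all of whose steps are unit steps north ($N$, adding $(0,1)$) or east ($E$, adding $(1,0)$). Call two points $v,w\in\mathbb{Z}^2$ equivalent if $v-w=\ell\,(r,2)$ for some $\ell\in\mathbb{Z}$. A lattice path is called valid if, whenever it enters a point $v$ with an $E$-step, every later point of the path that is equivalent to $v$ is also entered with an $E$-step. Then the number of valid lattice paths from $(0,0)$ to $(nr,2n)$ is exactly $$\binom{r+2}{2}^{n}.$$ -/

import Mathlib

/-- The two kinds of steps of a lattice path: a unit step north or a unit step east. -/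
inductive LatticeStep where
  | N : LatticeStep
  | E : LatticeStep

/-- The displacement of a step: `N` is `(0, 1)` and `E` is `(1, 0)`. -/
def LatticeStep.vec : LatticeStep → ℤ × ℤ
  | .N => (0, 1)
  | .E => (1, 0)

/-- A (finite) north/east lattice path in `ℤ²`: a starting point and a sequence of unit steps. -/
structure LatticePath where
  start : ℤ × ℤ
  steps : List LatticeStep

namespace LatticePath

/-- The vertex reached after the first `i` steps. In particular `P.vertex 0 = P.start`, and for
`i < P.steps.length` the step `P.steps[i]` leads from `P.vertex i` into `P.vertex (i + 1)`. -/
def vertex (P : LatticePath) (i : ℕ) : ℤ × ℤ :=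
  P.start + ((P.steps.take i).map LatticeStep.vec).sum

/-- The last vertex of a path. -/
def finish (P : LatticePath) : ℤ × ℤ :=
  P.vertex P.steps.length

/-- Two points of `ℤ²` are equivalent if they differ by an integer multiple of `(r, s)`. -/
def Equivalent (r s : ℕ) (v w : ℤ × ℤ) : Prop :=
  ∃ l : ℤ, v - w = l • ((r : ℤ), (s : ℤ))

/-- A path is valid if, whenever it enters a point `v` with an `E`-step, every later point of the
path that is equivalent to `v` is also entered with an `E`-step. -/
def IsValid (r s : ℕ) (P : LatticePath) : Prop :=
  ∀ i j : ℕ, ∀ hi : i < P.steps.length, ∀ hj : j < P.steps.length, i < j →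
    P.steps[i] = LatticeStep.E →
    Equivalent r s (P.vertex (j + 1)) (P.vertex (i + 1)) →
    P.steps[j] = LatticeStep.E

/-- The set of valid paths from the origin to `(n r, n s)`. -/
def validPaths (r s n : ℕ) : Set LatticePath :=
  {P | P.start = (0, 0) ∧ P.finish = ((n : ℤ) * r, (n : ℤ) * s) ∧ P.IsValid r s}

end LatticePath

/-! Read backwards and projected to the cylinder `ℤ² / ℤ(r, 2)`, a valid path becomes a closed walk
of length `n (r + 2)` in which a vertex once left by `N` is left only by `N` afterwards. The
simplest such walks are the loops of length `r + 2`, one for each `p ≤ q ≤ p + r`, with `N`-exits at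
`p` in row `false` and `q` in row `true`. The count follows by removing one loop at a time.

In a nonempty closed walk let `p` and `q` be the leftmost `N`-exits of the two rows. A crossing
argument shows that the walk uses every step of this loop (`IsTop.mem_exits`), and validity forces
it to run through the loop without interruption from the first loop vertex it meets
(`exists_eq_loopWord_append`). Cutting the loop out leaves a shorter valid walk
(`exists_insertLoop_eq`). Conversely, a loop that touches a walk and lies weakly to its left can be
inserted at the first common vertex, and is then the leftmost loop of the result (`insertLoop_mem`),
so it can be recovered. The number of such loops is `(r + 2).choose 2` for every walk
(`exists_finset_admissible`), which gives the factor in `ncard_closedWords_succ`. -/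

namespace FoldedWalk

/-! ### Backward walks on the cylinder -/

/-- The cylinder `ℤ² / ℤ(r, 2)` is modelled by `ℤ × Bool`; `back r b` undoes the step `b`. -/
def back (r : ℕ) : LatticeStep → ℤ × Bool → ℤ × Bool
  | .E, (x, t) => (x - 1, t)
  | .N, (x, true) => (x, false)
  | .N, (x, false) => (x + r, true)

/-- The end of the backward walk from `c` along a word. -/
def run (r : ℕ) (c : ℤ × Bool) : List LatticeStep → ℤ × Bool
  | [] => c
  | b :: l => run r (back r b c) l

/-- The list of the vertices left by the backward walk from `c`, with the steps used. -/
def exits (r : ℕ) (c : ℤ × Bool) : List LatticeStep → List ((ℤ × Bool) × LatticeStep)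
  | [] => []
  | b :: l => (c, b) :: exits r (back r b c) l

/-- The backward walk visits the vertex `v`. -/
def Visits (r : ℕ) (c : ℤ × Bool) (l : List LatticeStep) (v : ℤ × Bool) : Prop :=
  ∃ l₁ l₂, l = l₁ ++ l₂ ∧ run r c l₁ = v

/-- No vertex left by an `E`-step was left earlier by an `N`-step. -/
def Valid (r : ℕ) (c : ℤ × Bool) (l : List LatticeStep) : Prop :=
  (exits r c l).Pairwise fun e f => e.1 = f.1 → e.2 = .N → f.2 = .N

variable {r : ℕ}

theorem run_append (c : ℤ × Bool) (l₁ l₂ : List LatticeStep) :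
    run r c (l₁ ++ l₂) = run r (run r c l₁) l₂ := by
  induction l₁ generalizing c with
  | nil => rfl
  | cons b l ih => exact ih _

theorem exits_append (c : ℤ × Bool) (l₁ l₂ : List LatticeStep) :
    exits r c (l₁ ++ l₂) = exits r c l₁ ++ exits r (run r c l₁) l₂ := by
  induction l₁ generalizing c with
  | nil => rfl
  | cons b l ih => exact congrArg _ (ih _)

theorem exists_split_of_mem_exits {c : ℤ × Bool} {l : List LatticeStep}
    {e : (ℤ × Bool) × LatticeStep} (he : e ∈ exits r c l) :
    ∃ l₁ l₂, l = l₁ ++ e.2 :: l₂ ∧ run r c l₁ = e.1 := by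
  induction l generalizing c with
  | nil => simp [exits] at he
  | cons b l ih =>
    rcases List.mem_cons.1 he with rfl | h
    · exact ⟨[], l, rfl, rfl⟩
    · obtain ⟨l₁, l₂, h₁, h₂⟩ := ih h
      exact ⟨b :: l₁, l₂, by simp [h₁], h₂⟩

theorem visits_of_mem_exits {c : ℤ × Bool} {l : List LatticeStep}
    {e : (ℤ × Bool) × LatticeStep} (he : e ∈ exits r c l) : Visits r c l e.1 := by
  obtain ⟨l₁, l₂, h₁, h₂⟩ := exists_split_of_mem_exits he
  exact ⟨l₁, _, h₁, h₂⟩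

theorem visits_back_of_mem_exits {c : ℤ × Bool} {l : List LatticeStep}
    {e : (ℤ × Bool) × LatticeStep} (he : e ∈ exits r c l) : Visits r c l (back r e.2 e.1) := by
  obtain ⟨l₁, l₂, h₁, h₂⟩ := exists_split_of_mem_exits he
  exact ⟨l₁ ++ [e.2], l₂, by simp [h₁], by rw [run_append, h₂]; rfl⟩

theorem exists_crossing {c : ℤ × Bool} {l : List LatticeStep} {R : Set (ℤ × Bool)}
    (hc : c ∈ R) (hl : run r c l ∉ R) :
    ∃ e ∈ exits r c l, e.1 ∈ R ∧ back r e.2 e.1 ∉ R := by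
  induction l generalizing c with
  | nil => exact absurd hc hl
  | cons b l ih =>
    by_cases h : back r b c ∈ R
    · obtain ⟨e, he, h'⟩ := ih h hl
      exact ⟨e, List.mem_cons_of_mem _ he, h'⟩
    · exact ⟨(c, b), List.mem_cons_self, hc, h⟩

/-- A closed walk that visits both a set and its complement leaves the set. -/
theorem exists_crossing_of_visits {c : ℤ × Bool} {l : List LatticeStep} {R : Set (ℤ × Bool)}
    (hcl : run r c l = c) {v w : ℤ × Bool} (hv : Visits r c l v) (hw : Visits r c l w)
    (hvR : v ∈ R) (hwR : w ∉ R) :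
    ∃ e ∈ exits r c l, e.1 ∈ R ∧ back r e.2 e.1 ∉ R := by
  by_cases hc : c ∈ R
  · obtain ⟨l₁, l₂, rfl, rfl⟩ := hw
    obtain ⟨e, he, h⟩ := exists_crossing hc hwR
    exact ⟨e, by rw [exits_append]; exact List.mem_append_left _ he, h⟩
  · obtain ⟨l₁, l₂, rfl, rfl⟩ := hv
    rw [run_append] at hcl
    obtain ⟨e, he, h⟩ := exists_crossing (l := l₂) hvR (by rwa [hcl])
    exact ⟨e, by rw [exits_append]; exact List.mem_append_right _ he, h⟩

/-! ### Loops around the cylinder -/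

/-- The vertices of the loop that meets row `false` in `[p, q]` and row `true` in `[q, p + r]`. -/
def loopSet (r : ℕ) (g : ℤ × ℤ) : Set (ℤ × Bool) :=
  {v | (v.2 = false ∧ g.1 ≤ v.1 ∧ v.1 ≤ g.2) ∨ (v.2 = true ∧ g.2 ≤ v.1 ∧ v.1 ≤ g.1 + r)}

/-- The step by which the loop leaves (backwards) a vertex. -/
def loopStep (g : ℤ × ℤ) (v : ℤ × Bool) : LatticeStep :=
  if v = (g.1, false) ∨ v = (g.2, true) then .N else .E

/-- The vertex following (backwards) a vertex of the loop. -/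
def loopNext (r : ℕ) (g : ℤ × ℤ) (v : ℤ × Bool) : ℤ × Bool := back r (loopStep g v) v

/-- The position of a vertex on the loop. -/
def loopRank (g : ℤ × ℤ) (v : ℤ × Bool) : ℤ := v.1 - g.1 + if v.2 then 1 else 0

/-- The first `k` steps of the loop, from the vertex `c`. -/
def loopWord (r : ℕ) (g : ℤ × ℤ) (c : ℤ × Bool) (k : ℕ) : List LatticeStep :=
  (List.range k).map fun i => loopStep g ((loopNext r g)^[i] c)

theorem loopWord_succ (g : ℤ × ℤ) (c : ℤ × Bool) (k : ℕ) :
    loopWord r g c (k + 1) = loopWord r g c k ++ [loopStep g ((loopNext r g)^[k] c)] := by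
  simp [loopWord, List.range_succ]

theorem run_loopWord (g : ℤ × ℤ) (c : ℤ × Bool) (k : ℕ) :
    run r c (loopWord r g c k) = (loopNext r g)^[k] c := by
  induction k with
  | zero => rfl
  | succ k ih => rw [loopWord_succ, run_append, ih, Function.iterate_succ_apply']; rfl

theorem exits_loopWord (g : ℤ × ℤ) (c : ℤ × Bool) (k : ℕ) :
    exits r c (loopWord r g c k) = (List.range k).map fun i =>
      ((loopNext r g)^[i] c, loopStep g ((loopNext r g)^[i] c)) := by
  induction k with
  | zero => rfl
  | succ k ih => rw [loopWord_succ, exits_append, ih, run_loopWord, List.range_succ]; simp [exits]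

theorem loopStep_eq_N_iff {g : ℤ × ℤ} {v : ℤ × Bool} :
    loopStep g v = .N ↔ v = (g.1, false) ∨ v = (g.2, true) := by
  unfold loopStep; split_ifs with h <;> simp [h]

/-- Row `false` of the loop carries the ranks `0, …, q - p` and row `true` the ranks `q - p + 1, …,
r + 1`, so the loop is a copy of the cycle of integers modulo `r + 2`. -/
theorem loopNext_mem {g : ℤ × ℤ} (h₁ : g.1 ≤ g.2) (h₂ : g.2 ≤ g.1 + r) {v : ℤ × Bool}
    (hv : v ∈ loopSet r g) : loopNext r g v ∈ loopSet r g ∧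
      loopRank g (loopNext r g v) = (loopRank g v - 1) % (r + 2) := by
  obtain ⟨p, q⟩ := g
  obtain ⟨x, t⟩ := v
  cases t <;> simp [loopSet, loopNext, loopStep, loopRank] at hv h₁ h₂ ⊢
  · by_cases hx : x = p
    · subst hx
      simp [back]
      refine ⟨h₂, ?_⟩
      -- Rank `0` is the only one that wraps around, to `r + 1`.
      rw [← Int.add_emod_right, Int.emod_eq_of_lt] <;> omega
    · simp [hx, back]
      refine ⟨by omega, ?_⟩
      rw [Int.emod_eq_of_lt] <;> omega
  · by_cases hx : x = q
    · subst hx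
      simp [back]
      refine ⟨h₁, ?_⟩
      rw [Int.emod_eq_of_lt] <;> omega
    · simp [hx, back]
      refine ⟨by omega, ?_⟩
      rw [Int.emod_eq_of_lt] <;> omega

theorem loopRank_bounds {g : ℤ × ℤ} (h₁ : g.1 ≤ g.2) (h₂ : g.2 ≤ g.1 + r) {v : ℤ × Bool}
    (hv : v ∈ loopSet r g) : 0 ≤ loopRank g v ∧ loopRank g v < r + 2 := by
  obtain ⟨p, q⟩ := g
  obtain ⟨x, t⟩ := v
  cases t <;> simp [loopSet, loopRank] at hv h₁ h₂ ⊢ <;> omega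

theorem loopRank_injOn {g : ℤ × ℤ} : Set.InjOn (loopRank g) (loopSet r g) := by
  rintro ⟨x, t⟩ hv ⟨y, t'⟩ hw h
  obtain ⟨p, q⟩ := g
  cases t <;> cases t' <;> simp [loopSet, loopRank] at hv hw h ⊢ <;> omega

theorem iterate_loopNext_mem {g : ℤ × ℤ} (h₁ : g.1 ≤ g.2) (h₂ : g.2 ≤ g.1 + r) {v : ℤ × Bool}
    (hv : v ∈ loopSet r g) (k : ℕ) : (loopNext r g)^[k] v ∈ loopSet r g ∧
      loopRank g ((loopNext r g)^[k] v) = (loopRank g v - k) % (r + 2) := by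
  induction k with
  | zero =>
    obtain ⟨h, h'⟩ := loopRank_bounds h₁ h₂ hv
    simp [hv, Int.emod_eq_of_lt h h']
  | succ k ih =>
    rw [Function.iterate_succ_apply']
    obtain ⟨h, h'⟩ := loopNext_mem h₁ h₂ ih.1
    refine ⟨h, ?_⟩
    rw [h', ih.2, Int.emod_sub_emod]
    congr 1
    push_cast
    ring

theorem iterate_loopNext_period {g : ℤ × ℤ} (h₁ : g.1 ≤ g.2) (h₂ : g.2 ≤ g.1 + r)
    {v : ℤ × Bool} (hv : v ∈ loopSet r g) : (loopNext r g)^[r + 2] v = v := by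
  obtain ⟨h, h'⟩ := iterate_loopNext_mem h₁ h₂ hv (r + 2)
  obtain ⟨h₃, h₄⟩ := loopRank_bounds h₁ h₂ hv
  refine loopRank_injOn h hv ?_
  rw [h']
  push_cast
  rw [Int.sub_emod_right, Int.emod_eq_of_lt h₃ h₄]

theorem iterate_loopNext_ne {g : ℤ × ℤ} (h₁ : g.1 ≤ g.2) (h₂ : g.2 ≤ g.1 + r)
    {v : ℤ × Bool} (hv : v ∈ loopSet r g) {i j : ℕ} (hij : i < j) (hj : j < r + 2) :
    (loopNext r g)^[i] v ≠ (loopNext r g)^[j] v := by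
  intro h
  have h' := congrArg (loopRank g) h
  rw [(iterate_loopNext_mem h₁ h₂ hv i).2, (iterate_loopNext_mem h₁ h₂ hv j).2] at h'
  have h₃ := Int.le_of_dvd (by omega)
    (Int.dvd_of_emod_eq_zero (Int.emod_eq_emod_iff_emod_sub_eq_zero.1 h'))
  omega

theorem exists_iterate_loopNext_eq {g : ℤ × ℤ} (h₁ : g.1 ≤ g.2) (h₂ : g.2 ≤ g.1 + r)
    {v w : ℤ × Bool} (hv : v ∈ loopSet r g) (hw : w ∈ loopSet r g) :
    ∃ k < r + 2, (loopNext r g)^[k] v = w := by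
  have hm : (0 : ℤ) < r + 2 := by omega
  have h₃ := Int.emod_nonneg (loopRank g v - loopRank g w) hm.ne'
  have h₄ := Int.emod_lt_of_pos (loopRank g v - loopRank g w) hm
  obtain ⟨h₅, h₆⟩ := loopRank_bounds h₁ h₂ hw
  refine ⟨((loopRank g v - loopRank g w) % (r + 2)).toNat, by omega, ?_⟩
  obtain ⟨h, h'⟩ := iterate_loopNext_mem h₁ h₂ hv
    ((loopRank g v - loopRank g w) % (r + 2)).toNat
  refine loopRank_injOn h hw ?_
  rw [h', Int.toNat_of_nonneg h₃, Int.sub_emod_emod, sub_sub_cancel, Int.emod_eq_of_lt h₅ h₆]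

theorem mem_exits_loopWord {g : ℤ × ℤ} (h₁ : g.1 ≤ g.2) (h₂ : g.2 ≤ g.1 + r)
    {c : ℤ × Bool} (hc : c ∈ loopSet r g) {e : (ℤ × Bool) × LatticeStep} :
    e ∈ exits r c (loopWord r g c (r + 2)) ↔ e.1 ∈ loopSet r g ∧ e.2 = loopStep g e.1 := by
  rw [exits_loopWord, List.mem_map]
  constructor
  · rintro ⟨k, -, rfl⟩
    exact ⟨(iterate_loopNext_mem h₁ h₂ hc k).1, rfl⟩
  · rintro ⟨h, h'⟩
    obtain ⟨k, hk, h''⟩ := exists_iterate_loopNext_eq h₁ h₂ hc h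
    exact ⟨k, List.mem_range.2 hk, Prod.ext h'' (by rw [h', ← h''])⟩

theorem valid_loopWord {g : ℤ × ℤ} (h₁ : g.1 ≤ g.2) (h₂ : g.2 ≤ g.1 + r)
    {c : ℤ × Bool} (hc : c ∈ loopSet r g) : Valid r c (loopWord r g c (r + 2)) := by
  unfold Valid
  rw [exits_loopWord, List.pairwise_map]
  refine (List.pairwise_lt_range).imp_of_mem ?_
  intro i j _ hj hij h
  exact absurd h (iterate_loopNext_ne h₁ h₂ hc hij (List.mem_range.1 hj))

/-- A valid walk that starts on a loop and runs above it nowhere follows the loop once. -/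
theorem exists_eq_loopWord_append {g : ℤ × ℤ} (h₁ : g.1 ≤ g.2) (h₂ : g.2 ≤ g.1 + r)
    {c : ℤ × Bool} (hc : c ∈ loopSet r g) {l : List LatticeStep} (hl : Valid r c l)
    (hG : ∀ v ∈ loopSet r g, (v, loopStep g v) ∈ exits r c l)
    (hN : ∀ v ∈ loopSet r g, loopStep g v = .N → (v, LatticeStep.E) ∉ exits r c l) :
    ∃ l₂, l = loopWord r g c (r + 2) ++ l₂ := by
  suffices ∀ k ≤ r + 2, ∃ l₂, l = loopWord r g c k ++ l₂ from this _ le_rfl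
  intro k
  induction k with
  | zero => exact fun _ => ⟨l, rfl⟩
  | succ k ih =>
    intro hk
    obtain ⟨l₂, rfl⟩ := ih (by omega)
    have hd := (iterate_loopNext_mem h₁ h₂ hc k).1
    have hmem := hG _ hd
    have hNd := hN _ hd
    unfold Valid at hl
    rw [exits_append, run_loopWord] at hmem hNd hl
    rw [List.mem_append] at hmem
    rw [List.pairwise_append] at hl
    rcases hmem with hmem | hmem
    · rw [exits_loopWord, List.mem_map] at hmem
      obtain ⟨i, hi, h⟩ := hmem
      exact absurd (Prod.ext_iff.1 h).1
        (iterate_loopNext_ne h₁ h₂ hc (List.mem_range.1 hi) (by omega))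
    · cases l₂ with
      | nil => simp [exits] at hmem
      | cons b l₃ =>
        refine ⟨l₃, ?_⟩
        rw [loopWord_succ]
        suffices b = loopStep g ((loopNext r g)^[k] c) by simp [this]
        have hp := hl.2.1
        simp only [exits, List.pairwise_cons] at hp hmem
        -- Where the loop steps `N`, an `E`-exit is excluded by `hN`. Where it steps `E`, that exit
        -- is still to come, so an `N`-exit now would violate validity.
        cases hs : loopStep g ((loopNext r g)^[k] c) <;> cases b
        · rfl
        · exact absurd (List.mem_append_right _ List.mem_cons_self) (hNd hs)
        · rw [hs] at hmem
          rcases List.mem_cons.1 hmem with h | h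
          · exact (Prod.ext_iff.1 h).2.symm
          · exact (hp.1 _ h rfl rfl).symm
        · rfl

/-! ### Inserting a loop into a walk -/

open Classical in
/-- Insert a loop at the first vertex of the walk that lies on it. -/
noncomputable def insertLoop (r : ℕ) (g : ℤ × ℤ) (c : ℤ × Bool) :
    List LatticeStep → List LatticeStep
  | [] => if c ∈ loopSet r g then loopWord r g c (r + 2) else []
  | b :: l => if c ∈ loopSet r g then loopWord r g c (r + 2) ++ b :: l
      else b :: insertLoop r g (back r b c) l

theorem insertLoop_injective (g : ℤ × ℤ) (c : ℤ × Bool) {l l' : List LatticeStep}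
    (h : insertLoop r g c l = insertLoop r g c l') (hlen : l.length = l'.length) : l = l' := by
  induction l generalizing c l' with
  | nil => exact (List.length_eq_zero_iff.1 hlen.symm).symm
  | cons b l ih =>
    cases l' with
    | nil => simp at hlen
    | cons b' l' =>
      unfold insertLoop at h
      split_ifs at h with hc
      · exact List.append_cancel_left h
      · obtain ⟨rfl, h⟩ := List.cons.inj h
        rw [ih _ h (by simpa using hlen)]

theorem insertLoop_append {g : ℤ × ℤ} {c : ℤ × Bool} {l₁ : List LatticeStep}
    (l₂ : List LatticeStep) (h₁ : ∀ e ∈ exits r c l₁, e.1 ∉ loopSet r g)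
    (h : run r c l₁ ∈ loopSet r g) :
    insertLoop r g c (l₁ ++ l₂) = l₁ ++ (loopWord r g (run r c l₁) (r + 2) ++ l₂) := by
  induction l₁ generalizing c with
  | nil =>
    change c ∈ loopSet r g at h
    cases l₂ <;> simp [insertLoop, run, h]
  | cons b l ih =>
    simp only [exits, List.forall_mem_cons] at h₁
    simp only [List.cons_append, insertLoop, if_neg h₁.1]
    rw [ih h₁.2 h]
    rfl

/-- Split a walk at its first vertex in a given set. -/
theorem exists_first_visit {c : ℤ × Bool} {l : List LatticeStep} {G : Set (ℤ × Bool)}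
    {v : ℤ × Bool} (hv : Visits r c l v) (hG : v ∈ G) :
    ∃ l₁ l₂, l = l₁ ++ l₂ ∧ (∀ e ∈ exits r c l₁, e.1 ∉ G) ∧ run r c l₁ ∈ G := by
  obtain ⟨l₁, l₂, rfl, rfl⟩ := hv
  induction l₁ generalizing c with
  | nil => exact ⟨[], l₂, rfl, by simp [exits], hG⟩
  | cons b l ih =>
    by_cases hc : c ∈ G
    · exact ⟨[], _, rfl, by simp [exits], hc⟩
    · obtain ⟨l₁', l₂', h, h', h''⟩ := ih hG
      refine ⟨b :: l₁', l₂', by simp [h], ?_, h''⟩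
      simp only [exits, List.forall_mem_cons]
      exact ⟨hc, h'⟩

/-! ### Closed walks and their leftmost loops -/

/-- The valid closed backward walks that wind `n` times around the cylinder. -/
def closedWords (r n : ℕ) : Set (List LatticeStep) :=
  {l | l.length = n * (r + 2) ∧ run r (0, false) l = (0, false) ∧ Valid r (0, false) l}

/-- The walk leaves no vertex to the left of the loop by an `N`-step. -/
def Above (r : ℕ) (g : ℤ × ℤ) (l : List LatticeStep) : Prop :=
  (∀ x, ((x, false), LatticeStep.N) ∈ exits r (0, false) l → g.1 ≤ x) ∧
    ∀ x, ((x, true), LatticeStep.N) ∈ exits r (0, false) l → g.2 ≤ x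

/-- The loop is the leftmost one contained in the walk. -/
def IsTop (r : ℕ) (g : ℤ × ℤ) (l : List LatticeStep) : Prop :=
  Above r g l ∧ ((g.1, false), LatticeStep.N) ∈ exits r (0, false) l ∧
    ((g.2, true), LatticeStep.N) ∈ exits r (0, false) l

/-- The loop lies weakly to the left of the walk and touches it. -/
def Admissible (r : ℕ) (l : List LatticeStep) (g : ℤ × ℤ) : Prop :=
  (g.1 ≤ g.2 ∧ g.2 ≤ g.1 + r) ∧ Above r g l ∧ ∃ v ∈ loopSet r g, Visits r (0, false) l v

theorem IsTop.unique {g g' : ℤ × ℤ} {l : List LatticeStep} (h : IsTop r g l)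
    (h' : IsTop r g' l) : g = g' :=
  Prod.ext (le_antisymm (h.1.1 _ h'.2.1) (h'.1.1 _ h.2.1))
    (le_antisymm (h.1.2 _ h'.2.2) (h'.1.2 _ h.2.2))

/-- The walk must leave the part of row `t` up to `x`; an `E`-step moves left and stays inside, so
it leaves by `N`. -/
theorem exists_N_exit_le {c : ℤ × Bool} {l : List LatticeStep} (hcl : run r c l = c)
    {x : ℤ} {t : Bool} {w : ℤ × Bool} (hx : Visits r c l (x, t)) (hw : Visits r c l w)
    (h : ¬(w.2 = t ∧ w.1 ≤ x)) : ∃ y ≤ x, ((y, t), LatticeStep.N) ∈ exits r c l := by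
  obtain ⟨⟨⟨y, t'⟩, b⟩, he, h₁, h₂⟩ :=
    exists_crossing_of_visits (R := {v | v.2 = t ∧ v.1 ≤ x}) hcl hx hw ⟨rfl, le_rfl⟩ h
  obtain ⟨rfl, hy⟩ := h₁
  cases b
  · exact ⟨y, hy, he⟩
  · exact absurd ⟨rfl, by change y - 1 ≤ x; change y ≤ x at hy; omega⟩ h₂

/-- An `E`-exit would lead strictly to the left of the loop's `N`-exit in that row, and the walk
would then need a further `N`-exit there to return. -/
theorem Above.E_notMem {g : ℤ × ℤ} {l : List LatticeStep} (h : Above r g l)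
    (hcl : run r (0, false) l = (0, false)) {v : ℤ × Bool} (hv : loopStep g v = .N) :
    (v, LatticeStep.E) ∉ exits r (0, false) l := by
  intro he
  have h₁ := visits_of_mem_exits he
  have h₂ := visits_back_of_mem_exits he
  rcases loopStep_eq_N_iff.1 hv with rfl | rfl
  · obtain ⟨y, hy, hN⟩ := exists_N_exit_le hcl h₂ h₁ (by simp)
    have := h.1 y hN
    omega
  · obtain ⟨y, hy, hN⟩ := exists_N_exit_le hcl h₂ h₁ (by simp)
    have := h.2 y hN
    omega

theorem exists_least_exit {c : ℤ × Bool} {l : List LatticeStep} {t : Bool} {b : LatticeStep}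
    (h : ∃ x, ((x, t), b) ∈ exits r c l) :
    ∃ x, ((x, t), b) ∈ exits r c l ∧ ∀ y, ((y, t), b) ∈ exits r c l → x ≤ y := by
  have hf : {x | ((x, t), b) ∈ exits r c l}.Finite :=
    (List.finite_toSet (exits r c l)).preimage (f := fun x : ℤ => ((x, t), b))
      fun _ _ _ _ h => by simpa using h
  exact Set.exists_min_image _ id hf h

/-- Take the least `N`-exits `p` and `q` of the two rows. The step from `(q, true)` enters row
`false` at `q`, so that row is left by `N` at or before `q`, whence `p ≤ q`. Likewise `(p, false)`
leads to `(p + r, true)`, whence `q ≤ p + r`. -/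
theorem exists_isTop {l : List LatticeStep} (hcl : run r (0, false) l = (0, false))
    (hl : l ≠ []) : ∃ g : ℤ × ℤ, IsTop r g l ∧ g.1 ≤ g.2 ∧ g.2 ≤ g.1 + r := by
  have h₀ : ∃ x, ((x, false), LatticeStep.N) ∈ exits r (0, false) l := by
    cases l with
    | nil => exact absurd rfl hl
    | cons b l =>
      have hmem : (((0 : ℤ), false), b) ∈ exits r (0, false) (b :: l) := List.mem_cons_self
      cases b
      · exact ⟨0, hmem⟩
      · obtain ⟨y, -, h⟩ := exists_N_exit_le hcl (visits_back_of_mem_exits hmem)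
          (visits_of_mem_exits hmem) (by simp)
        exact ⟨y, h⟩
  have h₁ : ∃ x, ((x, true), LatticeStep.N) ∈ exits r (0, false) l := by
    obtain ⟨x, h⟩ := h₀
    obtain ⟨y, -, h'⟩ := exists_N_exit_le hcl (visits_back_of_mem_exits h)
      (visits_of_mem_exits h) (by simp)
    exact ⟨y, h'⟩
  obtain ⟨p, hp, hp'⟩ := exists_least_exit h₀
  obtain ⟨q, hq, hq'⟩ := exists_least_exit h₁
  refine ⟨(p, q), ⟨⟨hp', hq'⟩, hp, hq⟩, ?_, ?_⟩
  · obtain ⟨y, hy, h'⟩ := exists_N_exit_le hcl (visits_back_of_mem_exits hq)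
      (visits_of_mem_exits hq) (by simp)
    exact (hp' y h').trans hy
  · obtain ⟨y, hy, h'⟩ := exists_N_exit_le hcl (visits_back_of_mem_exits hp)
      (visits_of_mem_exits hp) (by simp)
    exact (hq' y h').trans hy

/-- To get to the left of `x` within its row, the walk either takes the `E`-step from `x` or enters
from the other row by an `N`-step. The latter would lie to the left of that row's least `N`-exit. -/
theorem IsTop.mem_exits {g : ℤ × ℤ} {l : List LatticeStep} (h : IsTop r g l)
    (hcl : run r (0, false) l = (0, false)) {v : ℤ × Bool} (hv : v ∈ loopSet r g) :
    (v, loopStep g v) ∈ exits r (0, false) l := by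
  cases hs : loopStep g v with
  | N => rcases loopStep_eq_N_iff.1 hs with rfl | rfl; exacts [h.2.1, h.2.2]
  | E =>
    obtain ⟨p, q⟩ := g
    obtain ⟨x, t⟩ := v
    have hN : ¬loopStep (p, q) (x, t) = .N := by simp [hs]
    rw [loopStep_eq_N_iff] at hN
    obtain ⟨⟨hA, hB⟩, hp, hq⟩ := h
    have hp' := visits_of_mem_exits hp
    have hq' := visits_of_mem_exits hq
    cases t <;> simp [loopSet] at hv hN
    · obtain ⟨⟨⟨y, t⟩, b⟩, he, h₁, h₂⟩ :=
        exists_crossing_of_visits (R := {v | ¬(v.2 = false ∧ v.1 < x)}) hcl hq' hp'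
          (by simp) (by simp; omega)
      cases t <;> cases b <;> simp [back] at h₁ h₂
      · obtain rfl : y = x := by omega
        exact he
      · have := hB _ he
        simp at this
        omega
    · obtain ⟨⟨⟨y, t⟩, b⟩, he, h₁, h₂⟩ :=
        exists_crossing_of_visits (R := {v | ¬(v.2 = true ∧ v.1 < x)}) hcl hp' hq'
          (by simp) (by simp; omega)
      cases t <;> cases b <;> simp [back] at h₁ h₂
      · have := hA _ he
        simp at this
        omega
      · obtain rfl : y = x := by omega
        exact he

/-! ### Insertion and removal of the leftmost loop -/

theorem insertLoop_mem {n : ℕ} {l : List LatticeStep} {g : ℤ × ℤ} (hl : l ∈ closedWords r n)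
    (hg : Admissible r l g) :
    insertLoop r g (0, false) l ∈ closedWords r (n + 1) ∧
      IsTop r g (insertLoop r g (0, false) l) := by
  obtain ⟨hlen, hcl, hv⟩ := hl
  obtain ⟨⟨h₁, h₂⟩, hA, v, hvG, hvis⟩ := hg
  have hE := fun v hv => hA.E_notMem hcl (v := v) hv
  obtain ⟨l₁, l₂, rfl, hl₁, hc⟩ := exists_first_visit hvis hvG
  rw [insertLoop_append l₂ hl₁ hc]
  have hrun := run_loopWord (r := r) g (run r (0, false) l₁) (r + 2)
  rw [iterate_loopNext_period h₁ h₂ hc] at hrun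
  have hex : exits r (0, false) (l₁ ++ (loopWord r g (run r (0, false) l₁) (r + 2) ++ l₂)) =
      exits r (0, false) l₁ ++ (exits r (run r (0, false) l₁)
        (loopWord r g (run r (0, false) l₁) (r + 2)) ++ exits r (run r (0, false) l₁) l₂) := by
    rw [exits_append, exits_append, hrun]
  have hmem := fun e => mem_exits_loopWord h₁ h₂ hc (e := e)
  unfold Valid at hv
  rw [exits_append, List.pairwise_append] at hv
  obtain ⟨hv₁, hv₂, hv₃⟩ := hv
  refine ⟨⟨?_, ?_, ?_⟩, ⟨?_, ?_⟩, ?_, ?_⟩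
  · simp only [List.length_append, loopWord, List.length_map, List.length_range] at hlen ⊢
    linarith
  · rw [run_append, run_append, hrun, ← run_append, hcl]
  · unfold Valid
    rw [hex, List.pairwise_append, List.pairwise_append]
    refine ⟨hv₁, ⟨valid_loopWord h₁ h₂ hc, hv₂, ?_⟩, ?_⟩
    -- The original walk never leaves an `N`-vertex of the loop by `E`, so the loop puts no new
    -- constraint on what follows it.
    · rintro e he ⟨v, b⟩ hf rfl h
      rw [hmem] at he
      cases b
      · rfl
      · refine absurd ?_ (hE e.1 (he.2.symm.trans h))
        rw [exits_append]
        exact List.mem_append_right _ hf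
    · intro e he f hf
      rcases List.mem_append.1 hf with hf | hf
      · intro h
        exact absurd (h ▸ ((hmem _).1 hf).1) (hl₁ e he)
      · exact hv₃ e he f hf
  · intro x hx
    rw [hex, List.mem_append, List.mem_append] at hx
    have := hA.1 x
    rw [exits_append, List.mem_append] at this
    rcases hx with hx | hx | hx
    · exact this (.inl hx)
    · rcases loopStep_eq_N_iff.1 ((hmem _).1 hx).2.symm with h | h <;> simp at h
      exact h.ge
    · exact this (.inr hx)
  · intro x hx
    rw [hex, List.mem_append, List.mem_append] at hx
    have := hA.2 x
    rw [exits_append, List.mem_append] at this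
    rcases hx with hx | hx | hx
    · exact this (.inl hx)
    · rcases loopStep_eq_N_iff.1 ((hmem _).1 hx).2.symm with h | h <;> simp at h
      exact h.ge
    · exact this (.inr hx)
  · rw [hex, List.mem_append, List.mem_append, hmem]
    exact .inr (.inl ⟨.inl ⟨rfl, le_rfl, h₁⟩, (loopStep_eq_N_iff.2 (.inl rfl)).symm⟩)
  · rw [hex, List.mem_append, List.mem_append, hmem]
    exact .inr (.inl ⟨.inr ⟨rfl, le_rfl, h₂⟩, (loopStep_eq_N_iff.2 (.inr rfl)).symm⟩)

theorem exists_insertLoop_eq {n : ℕ} {l : List LatticeStep} (hl : l ∈ closedWords r (n + 1)) :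
    ∃ l' ∈ closedWords r n, ∃ g, Admissible r l' g ∧ insertLoop r g (0, false) l' = l := by
  obtain ⟨hlen, hcl, hv⟩ := hl
  obtain ⟨g, htop, h₁, h₂⟩ := exists_isTop hcl (by rintro rfl; simp at hlen)
  have hE := fun v hv => htop.1.E_notMem hcl (v := v) hv
  have hG := fun v hv => htop.mem_exits hcl (v := v) hv
  obtain ⟨l₁, m, rfl, hl₁, hc⟩ := exists_first_visit (G := loopSet r g)
    (visits_of_mem_exits htop.2.1) (.inl ⟨rfl, le_rfl, h₁⟩)
  have hv' := hv
  unfold Valid at hv'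
  rw [exits_append] at hE hG hv'
  obtain ⟨l₂, rfl⟩ := exists_eq_loopWord_append h₁ h₂ hc (List.pairwise_append.1 hv').2.1
    (fun v hv => (List.mem_append.1 (hG v hv)).resolve_left fun h => hl₁ _ h hv)
    (fun v _ h hm => hE v h (List.mem_append_right _ hm))
  have hrun := run_loopWord (r := r) g (run r (0, false) l₁) (r + 2)
  rw [iterate_loopNext_period h₁ h₂ hc] at hrun
  have hsub : (exits r (0, false) (l₁ ++ l₂)).Sublist (exits r (0, false)
      (l₁ ++ (loopWord r g (run r (0, false) l₁) (r + 2) ++ l₂))) := by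
    rw [exits_append, exits_append, exits_append, hrun]
    exact (List.Sublist.refl _).append (List.sublist_append_right _ _)
  refine ⟨l₁ ++ l₂, ⟨?_, ?_, hv.sublist hsub⟩, g, ⟨⟨h₁, h₂⟩, ⟨?_, ?_⟩, _, hc, l₁, l₂, rfl, rfl⟩,
    insertLoop_append l₂ hl₁ hc⟩
  · simp only [List.length_append, loopWord, List.length_map, List.length_range] at hlen ⊢
    linarith
  · rwa [run_append, run_append, hrun, ← run_append] at hcl
  · exact fun x hx => htop.1.1 x (hsub.subset hx)
  · exact fun x hx => htop.1.2 x (hsub.subset hx)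

/-! ### Counting the admissible loops -/

/-- The pairs of naturals `l < k < m`. -/
def pairsBelow (m : ℕ) : Finset ((_ : ℕ) × ℕ) := (Finset.range m).sigma Finset.range

theorem card_pairsBelow (m : ℕ) : (pairsBelow m).card = m.choose 2 := by
  simp [pairsBelow, Finset.card_sigma, Finset.sum_range_id, Nat.choose_two_right]

theorem mem_pairsBelow {m : ℕ} {k : (_ : ℕ) × ℕ} : k ∈ pairsBelow m ↔ k.2 < k.1 ∧ k.1 < m := by
  simp [pairsBelow, and_comm]

/-- The number of loops through the origin. -/
theorem exists_finset_through_origin (r : ℕ) : ∃ F : Finset (ℤ × ℤ),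
    F.card = (r + 2).choose 2 ∧ ∀ g, g ∈ F ↔ g.1 ≤ 0 ∧ 0 ≤ g.2 ∧ g.2 ≤ g.1 + r := by
  -- With `k = p + r + 1` and `l = q` the conditions become `0 ≤ l < k < r + 2`.
  refine ⟨(pairsBelow (r + 2)).image fun k => ((k.1 : ℤ) - 1 - r, (k.2 : ℤ)), ?_, ?_⟩
  · rw [Finset.card_image_of_injective, card_pairsBelow]
    rintro ⟨k, l⟩ ⟨k', l'⟩ h
    simp at h
    obtain ⟨rfl, rfl⟩ := h
    rfl
  · rintro ⟨p, q⟩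
    simp only [Finset.mem_image, mem_pairsBelow, Prod.mk.injEq]
    constructor
    · rintro ⟨⟨k, l⟩, h, h₁, h₂⟩
      simp only at h h₁ h₂
      omega
    · rintro ⟨h₁, h₂, h₃⟩
      exact ⟨⟨(p + 1 + r).toNat, q.toNat⟩, by simp only; omega, by simp only; omega,
        by simp only; omega⟩

/-- The number of loops that touch a given loop and lie weakly to the left of it. -/
theorem exists_finset_touching {r : ℕ} {P Q : ℤ} (h₁ : P ≤ Q) (h₂ : Q ≤ P + r) :
    ∃ F : Finset (ℤ × ℤ), F.card = (r + 2).choose 2 ∧ ∀ g, g ∈ F ↔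
      (g.1 ≤ g.2 ∧ g.2 ≤ g.1 + r) ∧ (g.1 ≤ P ∧ g.2 ≤ Q) ∧ (P ≤ g.2 ∨ Q ≤ g.1 + r) := by
  -- If `q < P`, put `k = P - p` and `l = P - 1 - q`; touching means `k ≤ P + r - Q`. If `P ≤ q`,
  -- put `k = P + r + 1 - q` and `l = P - p`; then `q ≤ Q` means `k > P + r - Q`. The two ranges of
  -- `k` fit together to all pairs `l < k < r + 2`.
  refine ⟨(pairsBelow (r + 2)).image fun k => if (k.1 : ℤ) ≤ P + r - Q
    then (P - k.1, P - 1 - k.2) else (P - k.2, P + r + 1 - k.1), ?_, ?_⟩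
  · rw [Finset.card_image_of_injOn, card_pairsBelow]
    rintro ⟨k, l⟩ hk ⟨k', l'⟩ hk' h
    rw [Finset.mem_coe, mem_pairsBelow] at hk hk'
    simp only at h hk hk'
    have : k = k' ∧ l = l' := by split_ifs at h <;> rw [Prod.mk.injEq] at h <;> omega
    obtain ⟨rfl, rfl⟩ := this
    rfl
  · rintro ⟨p, q⟩
    simp only [Finset.mem_image, mem_pairsBelow]
    constructor
    · rintro ⟨⟨k, l⟩, h, h'⟩
      simp only at h h'
      split_ifs at h' <;> rw [Prod.mk.injEq] at h' <;> omega
    · rintro ⟨h, h', h''⟩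
      by_cases hq : q < P
      · refine ⟨⟨(P - p).toNat, (P - 1 - q).toNat⟩, by simp only; omega, ?_⟩
        simp only
        rw [if_pos (by omega), Prod.mk.injEq]
        omega
      · refine ⟨⟨(P + r + 1 - q).toNat, (P - p).toNat⟩, by simp only; omega, ?_⟩
        simp only
        rw [if_neg (by omega), Prod.mk.injEq]
        omega

/-- A loop weakly to the left of a nonempty walk touches it exactly when it contains one of the two
`N`-exits `(P, false)`, `(Q, true)` of the walk's leftmost loop. The empty walk visits only the
origin. -/
theorem exists_finset_admissible {n : ℕ} {l : List LatticeStep} (hl : l ∈ closedWords r n) :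
    ∃ F : Finset (ℤ × ℤ), F.card = (r + 2).choose 2 ∧ ∀ g, g ∈ F ↔ Admissible r l g := by
  by_cases hnil : l = []
  · subst hnil
    obtain ⟨F, hF, h⟩ := exists_finset_through_origin r
    refine ⟨F, hF, fun g => (h g).trans ⟨fun h' => ?_, ?_⟩⟩
    · exact ⟨⟨by omega, h'.2.2⟩, by simp [Above, exits], (0, false), .inl ⟨rfl, h'.1, h'.2.1⟩,
        [], [], rfl, rfl⟩
    · rintro ⟨h', -, v, hv, l₁, l₂, h, rfl⟩
      obtain ⟨rfl, rfl⟩ := List.append_eq_nil_iff.1 h.symm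
      simp [run, loopSet] at hv
      omega
  · have hcl := hl.2.1
    obtain ⟨⟨P, Q⟩, htop, h₁, h₂⟩ := exists_isTop hcl hnil
    obtain ⟨F, hF, h⟩ := exists_finset_touching h₁ h₂
    have hP := visits_of_mem_exits htop.2.1
    have hQ := visits_of_mem_exits htop.2.2
    refine ⟨F, hF, fun g => (h g).trans ⟨?_, ?_⟩⟩
    · rintro ⟨h, ⟨hp, hq⟩, h'⟩
      refine ⟨h, ⟨fun x hx => hp.trans (htop.1.1 x hx), fun x hx => hq.trans (htop.1.2 x hx)⟩, ?_⟩
      rcases h' with h' | h'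
      · exact ⟨_, .inl ⟨rfl, hp, h'⟩, hP⟩
      · exact ⟨_, .inr ⟨rfl, hq, h'⟩, hQ⟩
    · rintro ⟨h, hA, ⟨x, t⟩, hv, hvis⟩
      refine ⟨h, ⟨hA.1 _ htop.2.1, hA.2 _ htop.2.2⟩, ?_⟩
      cases t <;> simp [loopSet] at hv
      · left
        obtain ⟨y, hy, hN⟩ := exists_N_exit_le hcl hvis hQ (by simp)
        exact (htop.1.1 y hN).trans (hy.trans hv.2)
      · right
        obtain ⟨y, hy, hN⟩ := exists_N_exit_le hcl hvis hP (by simp)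
        exact (htop.1.2 y hN).trans (hy.trans hv.2)

/-! ### The recursion for the number of closed walks -/

instance : Finite LatticeStep :=
  Finite.of_injective (fun b => match b with | .N => true | .E => false) <| by
    rintro (_ | _) (_ | _) h <;> simp_all

theorem finite_closedWords (r n : ℕ) : (closedWords r n).Finite :=
  (List.finite_length_eq LatticeStep (n * (r + 2))).subset fun _ h => h.1

theorem ncard_closedWords_succ (r n : ℕ) :
    (closedWords r (n + 1)).ncard = (closedWords r n).ncard * (r + 2).choose 2 := by
  classical
  choose F hF hF' using fun l : closedWords r n => exists_finset_admissible l.2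
  have := (finite_closedWords r n).fintype
  have hs : ((Finset.univ : Finset (closedWords r n)).sigma F).card =
      (closedWords r n).ncard * (r + 2).choose 2 := by
    rw [Finset.card_sigma, Finset.sum_congr rfl fun l _ => hF l]
    rw [Finset.sum_const, smul_eq_mul, Finset.card_univ, ← Nat.card_eq_fintype_card,
      Nat.card_coe_set_eq]
  rw [← hs, Set.ncard_eq_toFinset_card _ (finite_closedWords r (n + 1))]
  symm
  refine Finset.card_bij (fun k _ => insertLoop r k.2 (0, false) k.1) ?_ ?_ ?_
  · rintro ⟨l, g⟩ h
    simp only [Finset.mem_sigma, Finset.mem_univ, true_and, hF'] at h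
    simpa using (insertLoop_mem l.2 h).1
  · rintro ⟨l, g⟩ h ⟨l', g'⟩ h' heq
    simp only [Finset.mem_sigma, Finset.mem_univ, true_and, hF'] at h h' heq
    have ht := (insertLoop_mem l.2 h).2
    obtain rfl := ht.unique (heq ▸ (insertLoop_mem l'.2 h').2)
    obtain rfl := Subtype.ext (insertLoop_injective _ _ heq (l.2.1.trans l'.2.1.symm))
    rfl
  · intro l hl
    obtain ⟨l', hl', g, hg, h⟩ := exists_insertLoop_eq ((Set.Finite.mem_toFinset _).1 hl)
    exact ⟨⟨⟨l', hl'⟩, g⟩, by simpa [hF'] using hg, h⟩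

theorem ncard_closedWords (r n : ℕ) :
    (closedWords r n).ncard = ((r + 2).choose 2) ^ n := by
  induction n with
  | zero =>
    rw [pow_zero, Set.ncard_eq_one]
    refine ⟨[], Set.eq_singleton_iff_unique_mem.2 ⟨⟨by simp, rfl, .nil⟩, fun l hl => ?_⟩⟩
    simpa using hl.1
  | succ n ih => rw [ncard_closedWords_succ, ih, pow_succ]

/-! ### From lattice paths to walks on the cylinder -/

/-- The projection of `ℤ²` to the cylinder. -/
def fold (r : ℕ) (v : ℤ × ℤ) : ℤ × Bool := (v.1 - r * (v.2 / 2), decide (v.2 % 2 = 1))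

theorem fold_eq_fold_iff {v w : ℤ × ℤ} :
    fold r v = fold r w ↔ LatticePath.Equivalent r 2 v w := by
  obtain ⟨a, b⟩ := v
  obtain ⟨x, y⟩ := w
  simp only [fold, LatticePath.Equivalent, Prod.mk.injEq, decide_eq_decide, Prod.mk_sub_mk,
    Prod.smul_mk, smul_eq_mul]
  constructor
  · rintro ⟨h, h'⟩
    have hb : b = y + (b / 2 - y / 2) * 2 := by omega
    refine ⟨b / 2 - y / 2, by linear_combination h, ?_⟩
    push_cast
    omega
  · rintro ⟨l, h, h'⟩
    push_cast at h'
    have hb : b / 2 = y / 2 + l := by omega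
    refine ⟨?_, by omega⟩
    rw [hb]
    linear_combination h

theorem back_fold (b : LatticeStep) (v : ℤ × ℤ) : back r b (fold r v) = fold r (v - b.vec) := by
  obtain ⟨x, y⟩ := v
  cases b
  · rcases Int.emod_two_eq_zero_or_one y with h | h
    · have h₁ : (y - 1) / 2 = y / 2 - 1 := by omega
      have h₂ : (y - 1) % 2 = 1 := by omega
      simp [fold, back, LatticeStep.vec, h, h₁, h₂]
      ring
    · have h₁ : (y - 1) / 2 = y / 2 := by omega
      have h₂ : (y - 1) % 2 = 0 := by omega
      simp [fold, back, LatticeStep.vec, h, h₁, h₂]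
  · simp [fold, back, LatticeStep.vec]
    ring

theorem run_fold (l : List LatticeStep) (v : ℤ × ℤ) :
    run r (fold r v) l = fold r (v - (l.map LatticeStep.vec).sum) := by
  induction l generalizing v with
  | nil => simp [run]
  | cons b l ih => rw [run, back_fold, ih, List.map_cons, List.sum_cons, sub_sub]

theorem sum_vec_fst_add_snd (l : List LatticeStep) :
    (l.map LatticeStep.vec).sum.1 + (l.map LatticeStep.vec).sum.2 = l.length := by
  induction l with
  | nil => rfl
  | cons b l ih => cases b <;> simp [LatticeStep.vec] <;> omega

theorem length_exits (c : ℤ × Bool) (l : List LatticeStep) :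
    (exits r c l).length = l.length := by
  induction l generalizing c with
  | nil => rfl
  | cons b l ih => simp [exits, ih]

theorem getElem_exits (c : ℤ × Bool) (l : List LatticeStep) (i : ℕ)
    (hi : i < (exits r c l).length) :
    (exits r c l)[i] = (run r c (l.take i), l[i]'(length_exits c l ▸ hi)) := by
  induction l generalizing c i with
  | nil => simp [exits] at hi
  | cons b l ih =>
    cases i with
    | zero => rfl
    | succ i => exact ih _ i (by simpa [exits] using hi)

/-- The lattice path from the origin with the given reversed step sequence. -/
def toPath (l : List LatticeStep) : LatticePath := ⟨(0, 0), l.reverse⟩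

theorem toPath_finish (l : List LatticeStep) :
    (toPath l).finish = (l.map LatticeStep.vec).sum := by
  simp only [LatticePath.finish, LatticePath.vertex, toPath, List.take_length, List.map_reverse,
    List.sum_reverse]
  exact zero_add _

theorem fold_toPath_vertex (l : List LatticeStep) (i : ℕ) :
    fold r ((toPath l).vertex (l.length - i)) =
      run r (fold r (toPath l).finish) (l.take i) := by
  rw [run_fold, toPath_finish]
  congr 1
  rw [eq_sub_iff_add_eq]
  conv_rhs => rw [← List.take_append_drop i l, List.map_append, List.sum_append, add_comm]
  simp only [LatticePath.vertex, toPath, List.take_reverse, List.map_reverse, List.sum_reverse]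
  congr 1
  by_cases hi : i ≤ l.length
  · rw [Nat.sub_sub_self hi]
    exact zero_add _
  · rw [Nat.sub_eq_zero_of_le (not_le.1 hi).le, Nat.sub_zero, List.drop_length,
      List.drop_eq_nil_of_le (not_le.1 hi).le]
    rfl

/-- Reversal turns the entering step of a vertex into its leaving step, and the condition on `E`
into its contrapositive on `N`. -/
theorem isValid_toPath_iff (l : List LatticeStep) :
    (toPath l).IsValid r 2 ↔ Valid r (fold r (toPath l).finish) l := by
  unfold Valid LatticePath.IsValid
  rw [List.pairwise_iff_getElem]
  simp only [getElem_exits, length_exits, ← fold_toPath_vertex, fold_eq_fold_iff]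
  have hlen : (toPath l).steps.length = l.length := List.length_reverse
  have hget : ∀ i (hi : i < (toPath l).steps.length),
      (toPath l).steps[i] = l[l.length - 1 - i]'(by omega) := fun i hi => List.getElem_reverse _
  constructor
  · intro h i j hi hj hij heq hN
    have := h (l.length - 1 - j) (l.length - 1 - i) (by omega) (by omega) (by omega)
    simp only [hget] at this
    have e₁ : l.length - 1 - i + 1 = l.length - i := by omega
    have e₂ : l.length - 1 - j + 1 = l.length - j := by omega
    have e₃ : l.length - 1 - (l.length - 1 - i) = i := by omega
    have e₄ : l.length - 1 - (l.length - 1 - j) = j := by omega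
    simp only [e₁, e₂, e₃, e₄] at this
    cases hs : l[j]
    · rfl
    · exact absurd (this hs heq) (by simp [hN])
  · intro h i j hi hj hij hE heq
    have := h (l.length - 1 - j) (l.length - 1 - i) (by omega) (by omega) (by omega)
    rw [hget] at hE ⊢
    have e₁ : l.length - (l.length - 1 - i) = i + 1 := by omega
    have e₂ : l.length - (l.length - 1 - j) = j + 1 := by omega
    rw [e₁, e₂] at this
    cases hs : l[l.length - 1 - j]
    · exact absurd (this heq hs) (by simp [hE])
    · rfl

theorem fold_mul (n : ℕ) : fold r ((n : ℤ) * r, (n : ℤ) * (2 : ℕ)) = (0, false) := by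
  simp [fold]
  ring

theorem toPath_mem_validPaths_iff {n : ℕ} {l : List LatticeStep} :
    toPath l ∈ LatticePath.validPaths r 2 n ↔ l ∈ closedWords r n := by
  have h₀ : fold r (0, 0) = (0, false) := by simp [fold]
  have hsum := sum_vec_fst_add_snd l
  rw [← toPath_finish] at hsum
  constructor
  · rintro ⟨-, hf, hv⟩
    rw [isValid_toPath_iff, hf, fold_mul] at hv
    refine ⟨?_, ?_, hv⟩
    · rw [hf] at hsum
      zify
      rw [← hsum]
      push_cast
      ring
    · have h := run_fold (r := r) l (toPath l).finish
      rwa [hf, fold_mul, ← hf, toPath_finish, sub_self, ← Prod.mk_zero_zero, h₀] at h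
  · rintro ⟨hlen, hcl, hv⟩
    have hf : (toPath l).finish = ((n : ℤ) * r, (n : ℤ) * (2 : ℕ)) := by
      rw [← h₀, run_fold, fold_eq_fold_iff, ← toPath_finish] at hcl
      obtain ⟨z, hz⟩ := hcl
      generalize (toPath l).finish = S at hz hsum
      obtain ⟨a, b⟩ := S
      simp at hz hsum
      rw [hlen] at hsum
      obtain ⟨h₁, h₂⟩ := hz
      -- Closedness gives the endpoint only as a multiple of `(r, 2)`; the length determines which
      -- one.
      have h₃ : (z + n) * ((r : ℤ) + 2) = 0 := by
        push_cast at hsum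
        linear_combination -h₁ - h₂ - hsum
      rcases mul_eq_zero.1 h₃ with h | h
      · obtain rfl : z = -n := by omega
        refine Prod.ext ?_ ?_
        · change a = n * r
          linear_combination -h₁
        · change b = n * (2 : ℕ)
          push_cast
          linear_combination -h₂
      · omega
    refine ⟨rfl, hf, ?_⟩
    rwa [isValid_toPath_iff, hf, fold_mul]

theorem toPath_injective : Function.Injective toPath := fun l l' h => by
  simpa [toPath] using h

theorem validPaths_eq_image (r n : ℕ) :
    LatticePath.validPaths r 2 n = toPath '' closedWords r n := by
  ext P
  constructor
  · intro h
    obtain ⟨v, s⟩ := P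
    obtain rfl : v = (0, 0) := h.1
    have hP : toPath s.reverse = ⟨(0, 0), s⟩ := by simp [toPath]
    exact ⟨s.reverse, toPath_mem_validPaths_iff.1 (hP ▸ h), hP⟩
  · rintro ⟨l, hl, rfl⟩
    exact toPath_mem_validPaths_iff.2 hl

end FoldedWalk

theorem mainTheorem1 (r n : ℕ) (hr : 0 < r) :
    (LatticePath.validPaths r 2 n).Finite ∧
      (LatticePath.validPaths r 2 n).ncard = ((r + 2).choose 2) ^ n := by
  rw [FoldedWalk.validPaths_eq_image]
  exact ⟨(FoldedWalk.finite_closedWords r n).image _, by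
    rw [Set.ncard_image_of_injective _ FoldedWalk.toPath_injective, FoldedWalk.ncard_closedWords]⟩
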